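/- **Calculus.** Formulae are built from variables $p_0,p_1,\dots$ and constants $\top,\bot,\mathbf 1$ using $\backslash$, $/$, $\cdot$, $\wedge$, $\vee$ and ${}^*$. Sequents are expressions $A_1,\dots,A_n\to B$ with $n\ge 0$. $\mathbf{ACT}_\omega$ (infinitary action logic) is the multiplicative-additive Lambek calculus (with cut, without Lambek's non-emptiness restriction, with the constants $\top,\bot,\mathbf 1$) extended by the rules for Kleene iteration: from $\Gamma,A^n,\Delta\to C$ for all $n\ge 0$ infer $\Gamma,A^*,\Delta\to C$; and, for each $n\ge0$, from $\Pi_1\to A,\dots,\Pi_n\to A$ infer $\Pi_1,\dots,\Pi_n\to A^*$. Derivations may be infinite but must be well-founded. **Algebraic models.** An $\omega$AL is a bounded lattice $K$ with a monoid structure $(K;\cdot,\mathbf 1)$, residuals satisfying $b\preceq a\backslash c\iff a\cdot b\preceq c\iff a\preceq c/b$, and $a^*=\sup\{a^n\mid n\ge0\}$. Given a valuation of the variables in $K$, extended homomorphically to formulae by $\alpha$, a sequent $A_1,\dots,A_n\to B$ is true if $\alpha(A_1)\cdots\alpha(A_n)\preceq\alpha(B)$ (the empty product being $\mathbf 1$).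 **SCL-models.** Let $\Sigma$ be an alphabet (possibly infinite) and $L\subseteq\Sigma^*$. For $M\subseteq\Sigma^*$ put $M^{\rhd}=\{(x,y)\in\Sigma^*\times\Sigma^*\mid \forall w\in M\; xwy\in L\}$, and for $C\subseteq\Sigma^*\times\Sigma^*$ put $C^{\lhd}=\{v\in\Sigma^*\mid\forall (x,y)\in C\; xvy\in L\}$. The syntactic concept lattice (SCL) of $L$ is $\mathcal B_L=\{M\subseteq\Sigma^*\mid M=M^{\rhd\lhd}\}$, ordered by inclusion. It is an $\omega$AL with meet $M\cap N$, join $(M\cup N)^{\rhd\lhd}$, product $(M\cdot N)^{\rhd\lhd}$, the usual divisions of languages, iteration $(M^*)^{\rhd\lhd}$, unit $\{\varepsilon\}^{\rhd\lhd}$, top $\Sigma^*$ and bottom $\varnothing^{\rhd\lhd}$. A *local zero* of $\mathcal B_L$ is an element $Z$ whose product with every $M\in\mathcal B_L$ such that $M\supseteq Z$, on either side, equals $Z$. If $Z$ is a local zero with $Z\subseteq\{\varepsilon\}^{\rhd\lhd}$, then the upper cone $\{M\in\mathcal B_L\mid M\supseteq Z\}$ is an $\omega$AL with the operations of $\mathcal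 B_L$, the same $\top$ and $\mathbf 1$, and with $Z$ as the new $\bot$. An *SCL-model with non-standard $\bot$* is an algebraic model over such an upper cone. It is *finite* if $\mathcal B_L$ is finite, and *regular* if $\Sigma$ is finite and $L$ is a regular language. **Theorem.** $\mathcal B_L$ is finite if and only if $L$ is recognised by a deterministic automaton with finitely many states (for every alphabet $\Sigma$, finite or not). Moreover, $\mathbf{ACT}_\omega$ is weakly complete with respect to finite SCL-models with non-standard $\bot$: every sequent that is true in all such models is derivable in $\mathbf{ACT}_\omega$ without hypotheses. The same holds with respect to regular SCL-models with non-standard $\bot$. -/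

import Mathlib

namespace ACT

/-! ### Formulae, sequents and the calculus -/

/-- Formulae of infinitary action logic over the countable set of variables `ℕ`. -/
inductive Formula : Type
  | var (n : ℕ) : Formula
  | top : Formula
  | bot : Formula
  | one : Formula
  /-- left division `A \ B` -/
  | ldiv (A B : Formula) : Formula
  /-- right division `B / A` -/
  | rdiv (B A : Formula) : Formula
  | mul (A B : Formula) : Formula
  | and (A B : Formula) : Formula
  | or (A B : Formula) : Formula
  | star (A : Formula) : Formula

/-- A sequent `A₁, …, Aₙ → C`; the left-hand side may be empty. -/
structure Sequent : Type where
  ante : List Formula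
  succ : Formula

/-- `Derives H Γ C`: the sequent `Γ → C` is derivable in `ACT_ω` from the set `H` of hypotheses.
Being an inductive predicate, it allows infinitely branching but only well-founded derivations. -/
inductive Derives (H : Set Sequent) : List Formula → Formula → Prop
  | hyp (s : Sequent) : s ∈ H → Derives H s.ante s.succ
  | id (A : Formula) : Derives H [A] A
  | botL (Γ Δ : List Formula) (C : Formula) : Derives H (Γ ++ [Formula.bot] ++ Δ) C
  | topR (Γ : List Formula) : Derives H Γ Formula.top
  | oneL (Γ Δ : List Formula) (C : Formula) :
      Derives H (Γ ++ Δ) C → Derives H (Γ ++ [Formula.one] ++ Δ) C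
  | oneR : Derives H [] Formula.one
  | mulL (Γ Δ : List Formula) (A B C : Formula) :
      Derives H (Γ ++ [A, B] ++ Δ) C → Derives H (Γ ++ [Formula.mul A B] ++ Δ) C
  | mulR (Γ Δ : List Formula) (A B : Formula) :
      Derives H Γ A → Derives H Δ B → Derives H (Γ ++ Δ) (Formula.mul A B)
  | ldivL (Γ Δ P : List Formula) (A B C : Formula) :
      Derives H P A → Derives H (Γ ++ [B] ++ Δ) C →
        Derives H (Γ ++ P ++ [Formula.ldiv A B] ++ Δ) C
  | ldivR (P : List Formula) (A B : Formula) :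
      Derives H ([A] ++ P) B → Derives H P (Formula.ldiv A B)
  | rdivL (Γ Δ P : List Formula) (A B C : Formula) :
      Derives H P A → Derives H (Γ ++ [B] ++ Δ) C →
        Derives H (Γ ++ [Formula.rdiv B A] ++ P ++ Δ) C
  | rdivR (P : List Formula) (A B : Formula) :
      Derives H (P ++ [A]) B → Derives H P (Formula.rdiv B A)
  | andL₁ (Γ Δ : List Formula) (A B C : Formula) :
      Derives H (Γ ++ [A] ++ Δ) C → Derives H (Γ ++ [Formula.and A B] ++ Δ) C
  | andL₂ (Γ Δ : List Formula) (A B C : Formula) :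
      Derives H (Γ ++ [B] ++ Δ) C → Derives H (Γ ++ [Formula.and A B] ++ Δ) C
  | andR (P : List Formula) (A B : Formula) :
      Derives H P A → Derives H P B → Derives H P (Formula.and A B)
  | orL (Γ Δ : List Formula) (A B C : Formula) :
      Derives H (Γ ++ [A] ++ Δ) C → Derives H (Γ ++ [B] ++ Δ) C →
        Derives H (Γ ++ [Formula.or A B] ++ Δ) C
  | orR₁ (P : List Formula) (A B : Formula) : Derives H P A → Derives H P (Formula.or A B)
  | orR₂ (P : List Formula) (A B : Formula) : Derives H P B → Derives H P (Formula.or A B)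
  | starL (Γ Δ : List Formula) (A C : Formula) :
      (∀ n : ℕ, Derives H (Γ ++ List.replicate n A ++ Δ) C) →
        Derives H (Γ ++ [Formula.star A] ++ Δ) C
  | starR (Ps : List (List Formula)) (A : Formula) :
      (∀ P ∈ Ps, Derives H P A) → Derives H Ps.flatten (Formula.star A)
  | cut (Γ Δ P : List Formula) (A C : Formula) :
      Derives H P A → Derives H (Γ ++ [A] ++ Δ) C → Derives H (Γ ++ P ++ Δ) C

/-- Derivability without hypotheses. -/
def Derivable (s : Sequent) : Prop := Derives ∅ s.ante s.succ

/-! ### Infinitary action lattices and algebraic models -/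

/-- Infinitary action lattices: bounded lattices with a monoid structure, both residuals of the
product, and a `*`-continuous Kleene star. -/
class OmegaAL (K : Type*) extends Lattice K, BoundedOrder K, Monoid K where
  /-- `ldiv a c` is `a \ c` -/
  ldiv : K → K → K
  /-- `rdiv c b` is `c / b` -/
  rdiv : K → K → K
  star : K → K
  le_ldiv_iff : ∀ a b c : K, b ≤ ldiv a c ↔ a * b ≤ c
  le_rdiv_iff : ∀ a b c : K, a ≤ rdiv c b ↔ a * b ≤ c
  isLUB_star : ∀ a : K, IsLUB (Set.range fun n : ℕ => a ^ n) (star a)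

/-- The extension of a valuation of the variables to all formulae. -/
def interp {K : Type*} [OmegaAL K] (v : ℕ → K) : Formula → K
  | .var n => v n
  | .top => ⊤
  | .bot => ⊥
  | .one => 1
  | .ldiv A B => OmegaAL.ldiv (interp v A) (interp v B)
  | .rdiv B A => OmegaAL.rdiv (interp v B) (interp v A)
  | .mul A B => interp v A * interp v B
  | .and A B => interp v A ⊓ interp v B
  | .or A B => interp v A ⊔ interp v B
  | .star A => OmegaAL.star (interp v A)

/-- Truth of a sequent in the algebraic model given by a valuation; the empty product is `1`. -/
def Holds {K : Type*} [OmegaAL K] (v : ℕ → K) (s : Sequent) : Prop :=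
  (s.ante.map (interp v)).prod ≤ interp v s.succ

/-! ### Upper cones of local zeroes -/

/-- `z` is a local zero: `a * z = z * a = z` for every `a ≥ z`. -/
def IsLocalZero {K : Type*} [OmegaAL K] (z : K) : Prop :=
  ∀ a : K, z ≤ a → a * z = z ∧ z * a = z

theorem omegaAL_mul_le_mul {K : Type*} [OmegaAL K] {a b c d : K} (h₁ : a ≤ b) (h₂ : c ≤ d) :
    a * c ≤ b * d := by
  have e₁ : b * c ≤ b * d :=
    (OmegaAL.le_ldiv_iff b c _).1 (h₂.trans ((OmegaAL.le_ldiv_iff b d _).2 le_rfl))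
  have e₂ : a * c ≤ b * c :=
    (OmegaAL.le_rdiv_iff a c _).1 (h₁.trans ((OmegaAL.le_rdiv_iff b c _).2 le_rfl))
  exact e₂.trans e₁

/-- The upper cone of a local zero `z` with `z ≤ 1`. -/
def UpperCone {K : Type*} [OmegaAL K] (z : K) (_hz : IsLocalZero z) (_h1 : z ≤ 1) : Type _ :=
  {a : K // z ≤ a}

namespace UpperCone

variable {K : Type*} [OmegaAL K] {z : K} {hz : IsLocalZero z} {h1 : z ≤ 1}

instance : Lattice (UpperCone z hz h1) :=
  Subtype.lattice (P := fun a => z ≤ a)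
    (fun _ _ ha _ => le_sup_of_le_left ha) (fun _ _ ha hb => le_inf ha hb)

instance : BoundedOrder (UpperCone z hz h1) where
  top := ⟨⊤, le_top⟩
  le_top a := (le_top : a.1 ≤ ⊤)
  bot := ⟨z, le_rfl⟩
  bot_le a := a.2

instance : Monoid (UpperCone z hz h1) where
  mul a b := ⟨a.1 * b.1, (hz a.1 a.2).1.symm.le.trans (omegaAL_mul_le_mul le_rfl b.2)⟩
  one := ⟨1, h1⟩
  mul_assoc a b c := Subtype.ext (mul_assoc a.1 b.1 c.1)
  one_mul a := Subtype.ext (one_mul a.1)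
  mul_one a := Subtype.ext (mul_one a.1)

theorem coe_pow (a : UpperCone z hz h1) (n : ℕ) : (a ^ n).1 = a.1 ^ n := by
  induction n with
  | zero => rw [pow_zero, pow_zero]; rfl
  | succ n ih => rw [pow_succ, pow_succ, ← ih]; rfl

/-- The upper cone with the operations of the whole structure, and with `z` as the new `⊥`. -/
instance : OmegaAL (UpperCone z hz h1) where
  ldiv a c := ⟨OmegaAL.ldiv a.1 c.1,
    (OmegaAL.le_ldiv_iff _ _ _).2 ((hz a.1 a.2).1.le.trans c.2)⟩
  rdiv c b := ⟨OmegaAL.rdiv c.1 b.1,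
    (OmegaAL.le_rdiv_iff _ _ _).2 ((hz b.1 b.2).2.le.trans c.2)⟩
  star a := ⟨OmegaAL.star a.1,
    h1.trans ((OmegaAL.isLUB_star a.1).1 ⟨0, pow_zero a.1⟩)⟩
  le_ldiv_iff a b c := OmegaAL.le_ldiv_iff a.1 b.1 c.1
  le_rdiv_iff a b c := OmegaAL.le_rdiv_iff a.1 b.1 c.1
  isLUB_star a := by
    constructor
    · rintro _ ⟨n, rfl⟩
      change (a ^ n).1 ≤ OmegaAL.star a.1
      rw [coe_pow]
      exact (OmegaAL.isLUB_star a.1).1 ⟨n, rfl⟩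
    · intro b hb
      change OmegaAL.star a.1 ≤ b.1
      refine (OmegaAL.isLUB_star a.1).2 ?_
      rintro _ ⟨n, rfl⟩
      have h : (a ^ n).1 ≤ b.1 := hb ⟨n, rfl⟩
      rwa [coe_pow] at h

end UpperCone

/-! ### Syntactic concept lattices -/

section SCL

variable {α : Type*} (L : Language α)

/-- `M^▷`: the contexts `(x, y)` with `x w y ∈ L` for all `w ∈ M`. -/
def contexts (M : Language α) : Set (List α × List α) :=
  {c | ∀ w ∈ M, c.1 ++ w ++ c.2 ∈ L}

/-- `C^◁`: the words `v` with `x v y ∈ L` for all `(x, y) ∈ C`. -/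
def wordsOf (C : Set (List α × List α)) : Language α :=
  {v | ∀ c ∈ C, c.1 ++ v ++ c.2 ∈ L}

/-- The closure `M^▷◁` of `M` with respect to `L`. -/
def cl (M : Language α) : Language α := wordsOf L (contexts L M)

/-- The set of closed languages, ordered by inclusion. -/
def SCL : Type _ := {M : Language α // cl L M = M}

variable {L}

theorem le_cl (M : Language α) : M ≤ cl L M := fun _ hw _ hc => hc _ hw

theorem cl_le {M N : Language α} (hN : cl L N = N) (h : M ≤ N) : cl L M ≤ N := by
  rw [← hN]
  exact fun v hv c hc => hv c fun w hw => hc w (h hw)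

theorem cl_mono {M N : Language α} (h : M ≤ N) : cl L M ≤ cl L N :=
  fun _ hv c hc => hv c fun w hw => hc w (h hw)

theorem cl_cl (M : Language α) : cl L (cl L M) = cl L M :=
  le_antisymm (fun _ hv c hc => hv c fun _ hw => hw c hc) (le_cl _)

theorem cl_of_le {M : Language α} (h : cl L M ≤ M) : cl L M = M := le_antisymm h (le_cl _)

theorem cl_mul_le (M N : Language α) : cl L M * N ≤ cl L (M * N) := by
  intro w hw
  obtain ⟨x, hx, y, hy, rfl⟩ := Language.mem_mul.1 hw
  intro c hc
  have h := hx (c.1, y ++ c.2) fun m hm => by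
    simpa [List.append_assoc] using hc (m ++ y) (Language.append_mem_mul hm hy)
  simpa [List.append_assoc] using h

theorem mul_cl_le (M N : Language α) : M * cl L N ≤ cl L (M * N) := by
  intro w hw
  obtain ⟨x, hx, y, hy, rfl⟩ := Language.mem_mul.1 hw
  intro c hc
  have h := hy (c.1 ++ x, c.2) fun n hn => by
    simpa [List.append_assoc] using hc (x ++ n) (Language.append_mem_mul hx hn)
  simpa [List.append_assoc] using h

theorem cl_cl_mul (M N : Language α) : cl L (cl L M * N) = cl L (M * N) :=
  le_antisymm (cl_le (cl_cl _) (cl_mul_le M N)) (cl_mono (mul_le_mul' (le_cl M) le_rfl))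

theorem cl_mul_cl (M N : Language α) : cl L (M * cl L N) = cl L (M * N) :=
  le_antisymm (cl_le (cl_cl _) (mul_cl_le M N)) (cl_mono (mul_le_mul' le_rfl (le_cl N)))

/-- `M₁ \ M₂ = {u | ∀ v ∈ M₁, vu ∈ M₂}`. -/
def langLdiv (M₁ M₂ : Language α) : Language α := {u | ∀ v ∈ M₁, v ++ u ∈ M₂}

/-- `M₂ / M₁ = {u | ∀ v ∈ M₁, uv ∈ M₂}`. -/
def langRdiv (M₂ M₁ : Language α) : Language α := {u | ∀ v ∈ M₁, u ++ v ∈ M₂}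

theorem le_langLdiv_iff (M N P : Language α) : N ≤ langLdiv M P ↔ M * N ≤ P := by
  constructor
  · intro h w hw
    obtain ⟨x, hx, y, hy, rfl⟩ := Language.mem_mul.1 hw
    exact h hy x hx
  · exact fun h u hu v hv => h (Language.append_mem_mul hv hu)

theorem le_langRdiv_iff (M N P : Language α) : M ≤ langRdiv P N ↔ M * N ≤ P := by
  constructor
  · intro h w hw
    obtain ⟨x, hx, y, hy, rfl⟩ := Language.mem_mul.1 hw
    exact h hx y hy
  · exact fun h u hu v hv => h (Language.append_mem_mul hu hv)

theorem cl_langLdiv (M : Language α) {P : Language α} (hP : cl L P = P) :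
    cl L (langLdiv M P) = langLdiv M P :=
  cl_of_le ((le_langLdiv_iff _ _ _).2 ((mul_cl_le _ _).trans
    (cl_le hP ((le_langLdiv_iff _ _ _).1 le_rfl))))

theorem cl_langRdiv {P : Language α} (hP : cl L P = P) (N : Language α) :
    cl L (langRdiv P N) = langRdiv P N :=
  cl_of_le ((le_langRdiv_iff _ _ _).2 ((cl_mul_le _ _).trans
    (cl_le hP ((le_langRdiv_iff _ _ _).1 le_rfl))))

namespace SCL

instance : PartialOrder (SCL L) := Subtype.partialOrder _

instance : Lattice (SCL L) where
  inf M N := ⟨M.1 ⊓ N.1, cl_of_le (le_inf (cl_le M.2 inf_le_left) (cl_le N.2 inf_le_right))⟩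
  inf_le_left M N := (inf_le_left : M.1 ⊓ N.1 ≤ M.1)
  inf_le_right M N := (inf_le_right : M.1 ⊓ N.1 ≤ N.1)
  le_inf M N P h₁ h₂ := (le_inf h₁ h₂ : M.1 ≤ N.1 ⊓ P.1)
  sup M N := ⟨cl L (M.1 ⊔ N.1), cl_cl _⟩
  le_sup_left M N := (le_sup_left.trans (le_cl _) : M.1 ≤ cl L (M.1 ⊔ N.1))
  le_sup_right M N := (le_sup_right.trans (le_cl _) : N.1 ≤ cl L (M.1 ⊔ N.1))
  sup_le M N P h₁ h₂ := (cl_le P.2 (sup_le h₁ h₂) : cl L (M.1 ⊔ N.1) ≤ P.1)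

instance : BoundedOrder (SCL L) where
  top := ⟨⊤, cl_of_le le_top⟩
  le_top M := (le_top : M.1 ≤ ⊤)
  bot := ⟨cl L ⊥, cl_cl _⟩
  bot_le M := (cl_le M.2 bot_le : cl L ⊥ ≤ M.1)

instance : Monoid (SCL L) where
  mul M N := ⟨cl L (M.1 * N.1), cl_cl _⟩
  one := ⟨cl L 1, cl_cl _⟩
  mul_assoc M N P := Subtype.ext (by
    change cl L (cl L (M.1 * N.1) * P.1) = cl L (M.1 * cl L (N.1 * P.1))
    rw [cl_cl_mul, cl_mul_cl, mul_assoc])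
  one_mul M := Subtype.ext (by
    change cl L (cl L 1 * M.1) = M.1
    rw [cl_cl_mul, one_mul, M.2])
  mul_one M := Subtype.ext (by
    change cl L (M.1 * cl L 1) = M.1
    rw [cl_mul_cl, mul_one, M.2])

theorem coe_pow (M : SCL L) (n : ℕ) : (M ^ n).1 = cl L (M.1 ^ n) := by
  induction n with
  | zero => rw [pow_zero, pow_zero]; rfl
  | succ n ih =>
    rw [pow_succ, pow_succ, ← cl_cl_mul, ← ih]; rfl

/-- The syntactic concept lattice of `L` is an infinitary action lattice; here
`M ⊔ N`, `M * N`, `1`, `⊥` and the star are the closures of the operations on languages. -/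
instance : OmegaAL (SCL L) where
  ldiv M P := ⟨langLdiv M.1 P.1, cl_langLdiv _ P.2⟩
  rdiv P N := ⟨langRdiv P.1 N.1, cl_langRdiv P.2 _⟩
  star M := ⟨cl L (KStar.kstar M.1), cl_cl _⟩
  le_ldiv_iff M N P := (le_langLdiv_iff M.1 N.1 P.1).trans
    ⟨fun h => cl_le P.2 h, fun h => (le_cl _).trans h⟩
  le_rdiv_iff M N P := (le_langRdiv_iff M.1 N.1 P.1).trans
    ⟨fun h => cl_le P.2 h, fun h => (le_cl _).trans h⟩
  isLUB_star M := by
    constructor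
    · rintro _ ⟨n, rfl⟩
      change (M ^ n).1 ≤ cl L (KStar.kstar M.1)
      rw [coe_pow, Language.kstar_eq_iSup_pow]
      exact cl_mono (le_iSup (fun i : ℕ => M.1 ^ i) n)
    · intro N hN
      change cl L (KStar.kstar M.1) ≤ N.1
      refine cl_le N.2 ?_
      rw [Language.kstar_eq_iSup_pow]
      refine iSup_le fun n => ?_
      have h : (M ^ n).1 ≤ N.1 := hN ⟨n, rfl⟩
      rw [coe_pow] at h
      exact (le_cl _).trans h

end SCL

end SCL

/-! ### SCL-models with non-standard `⊥` -/

/-- An SCL-model with non-standard `⊥`: a valuation in the upper cone of a local zero `Z` of the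
syntactic concept lattice of a language `L`, where `Z` lies below the unit. -/
structure SCLModel where
  Alphabet : Type
  L : Language Alphabet
  Z : SCL L
  isLocalZero : IsLocalZero Z
  le_one : Z ≤ 1
  val : ℕ → UpperCone Z isLocalZero le_one

namespace SCLModel

/-- Truth of a sequent in an SCL-model. -/
def IsTrue (M : SCLModel) (s : Sequent) : Prop := Holds M.val s

/-- The syntactic concept lattice has finitely many elements. -/
def IsFinite (M : SCLModel) : Prop := Finite (SCL M.L)

/-- The alphabet is finite and the language is regular. -/
def IsRegular (M : SCLModel) : Prop := Finite M.Alphabet ∧ M.L.IsRegular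

end SCLModel

/-- `ACT_ω` is weakly complete with respect to a class `𝓜` of SCL-models: every sequent which is
true in all models from `𝓜` is derivable without hypotheses. -/
def WeaklyComplete (𝓜 : Set SCLModel) : Prop :=
  ∀ s : Sequent, (∀ M ∈ 𝓜, M.IsTrue s) → Derivable s

end ACT

namespace ACT

/-! ### Finiteness of the syntactic concept lattice -/

/-! The finiteness criterion compares closed sets with two familiar finite objects. Every left
quotient of $L$ is closed, so a finite lattice leaves finitely many left quotients; conversely a
closed set is a union of classes of words inducing the same state transformation, and a finite
automaton has finitely many of these.

Weak completeness is proved by building a countermodel for each underivable sequent. In every rule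
instance with an underivable conclusion some premise is underivable. Keeping one such premise per
set of premises, and repeating, yields a set $F$ of sequents closed in the sense of `IsRefutation`.
It is finite (`exists_finite_isRefutation`), since a sequent has finitely many sets of premises
(`finite_setOf_rule`) and premises are smaller in the well-founded Dershowitz–Manna order
(`Rule.weight_lt`). The infinitary rule does no harm, because only one of its premises is kept.

The letters are two copies of a finite set of formulae, for antecedents and for succedents.
`refutationLang` removes from the marked words the finitely many codes of sequents in $F$, hence is
regular. By `refutation_truth` the interpretation of $A$ contains the letter $A$ and consists of
words $w$ for which $w\to A$ is not in $F$. A sequent of $F$ is therefore false in the model. Only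
rules other than cut are inspected, so cut elimination is not needed. The letter $\bot$ generates
the local zero that serves as bottom. Regular models are finite, so completeness for them gives it
for finite models. -/

theorem isRegular_of_finite_scl {α : Type*} {L : Language α} (h : Finite (SCL L)) :
    L.IsRegular := by
  refine Language.IsRegular.of_finite_range_leftQuotient ?_
  refine (Set.finite_range (fun M : SCL L => M.1)).subset ?_
  rintro _ ⟨x, rfl⟩
  refine ⟨⟨L.leftQuotient x, cl_of_le fun v hv => ?_⟩, rfl⟩
  have h := hv (x, []) fun w (hw : x ++ w ∈ L) => by simpa using hw
  rwa [List.append_nil] at h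

/-- Whether a word fits into a context depends only on the state transformation it induces, so a
closed set is recovered from a subset of the finite set `σ → σ`. -/
theorem finite_scl_of_isRegular {α : Type*} {L : Language α} (h : L.IsRegular) :
    Finite (SCL L) := by
  obtain ⟨σ, _, D, rfl⟩ := h
  let f : List α → σ → σ := fun w s => D.evalFrom s w
  have key : ∀ M : SCL D.accepts, ∀ v w, f v = f w → w ∈ M.1 → v ∈ M.1 := by
    intro M v w hvw hw
    rw [← M.2]
    intro c hc
    have h := hc w hw
    rw [DFA.mem_accepts, DFA.eval, DFA.evalFrom_of_append, DFA.evalFrom_of_append] at h ⊢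
    have e := congrFun hvw (D.evalFrom D.start c.1)
    simp only [f] at e
    rwa [e]
  refine Finite.of_injective (fun M : SCL D.accepts => f '' {w | w ∈ M.1}) ?_
  have sub : ∀ M N : SCL D.accepts, f '' {w | w ∈ M.1} = f '' {w | w ∈ N.1} → M.1 ≤ N.1 := by
    intro M N h w hw
    obtain ⟨v, hv, e⟩ : f w ∈ f '' {w | w ∈ N.1} := h ▸ Set.mem_image_of_mem f hw
    exact key N w v e.symm hv
  exact fun M N h => Subtype.ext (le_antisymm (sub M N h) (sub N M h.symm))

theorem isRegular_of_finite {α : Type*} {L : Language α} (h : Set.Finite {w | w ∈ L}) :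
    L.IsRegular := by
  refine Language.IsRegular.of_finite_range_leftQuotient ?_
  have hs : {v : List α | ∃ w ∈ L, v <:+ w}.Finite := by
    refine (h.biUnion fun w _ => (w.tails.finite_toSet)).subset ?_
    rintro v ⟨w, hw, hv⟩
    exact Set.mem_biUnion hw ((List.mem_tails v w).2 hv)
  refine hs.finite_subsets.subset ?_
  rintro _ ⟨x, rfl⟩ v hv
  exact ⟨x ++ v, hv, List.suffix_append x v⟩

/-! ### Cut-free rules -/

/-- `Rule t X`: the sequent `t` is the conclusion of an instance of a rule other than cut,
and `X` is the set of its premises. -/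
inductive Rule : Sequent → Set Sequent → Prop
  | id (A : Formula) : Rule ⟨[A], A⟩ ∅
  | botL (Γ Δ : List Formula) (C : Formula) : Rule ⟨Γ ++ [Formula.bot] ++ Δ, C⟩ ∅
  | topR (Γ : List Formula) : Rule ⟨Γ, Formula.top⟩ ∅
  | oneL (Γ Δ : List Formula) (C : Formula) :
      Rule ⟨Γ ++ [Formula.one] ++ Δ, C⟩ {⟨Γ ++ Δ, C⟩}
  | oneR : Rule ⟨[], Formula.one⟩ ∅
  | mulL (Γ Δ : List Formula) (A B C : Formula) :
      Rule ⟨Γ ++ [Formula.mul A B] ++ Δ, C⟩ {⟨Γ ++ [A, B] ++ Δ, C⟩}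
  | mulR (Γ Δ : List Formula) (A B : Formula) :
      Rule ⟨Γ ++ Δ, Formula.mul A B⟩ {⟨Γ, A⟩, ⟨Δ, B⟩}
  | ldivL (Γ Δ P : List Formula) (A B C : Formula) :
      Rule ⟨Γ ++ P ++ [Formula.ldiv A B] ++ Δ, C⟩ {⟨P, A⟩, ⟨Γ ++ [B] ++ Δ, C⟩}
  | ldivR (P : List Formula) (A B : Formula) : Rule ⟨P, Formula.ldiv A B⟩ {⟨[A] ++ P, B⟩}
  | rdivL (Γ Δ P : List Formula) (A B C : Formula) :
      Rule ⟨Γ ++ [Formula.rdiv B A] ++ P ++ Δ, C⟩ {⟨P, A⟩, ⟨Γ ++ [B] ++ Δ, C⟩}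
  | rdivR (P : List Formula) (A B : Formula) : Rule ⟨P, Formula.rdiv B A⟩ {⟨P ++ [A], B⟩}
  | andL₁ (Γ Δ : List Formula) (A B C : Formula) :
      Rule ⟨Γ ++ [Formula.and A B] ++ Δ, C⟩ {⟨Γ ++ [A] ++ Δ, C⟩}
  | andL₂ (Γ Δ : List Formula) (A B C : Formula) :
      Rule ⟨Γ ++ [Formula.and A B] ++ Δ, C⟩ {⟨Γ ++ [B] ++ Δ, C⟩}
  | andR (P : List Formula) (A B : Formula) : Rule ⟨P, Formula.and A B⟩ {⟨P, A⟩, ⟨P, B⟩}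
  | orL (Γ Δ : List Formula) (A B C : Formula) :
      Rule ⟨Γ ++ [Formula.or A B] ++ Δ, C⟩ {⟨Γ ++ [A] ++ Δ, C⟩, ⟨Γ ++ [B] ++ Δ, C⟩}
  | orR₁ (P : List Formula) (A B : Formula) : Rule ⟨P, Formula.or A B⟩ {⟨P, A⟩}
  | orR₂ (P : List Formula) (A B : Formula) : Rule ⟨P, Formula.or A B⟩ {⟨P, B⟩}
  | starL (Γ Δ : List Formula) (A C : Formula) :
      Rule ⟨Γ ++ [Formula.star A] ++ Δ, C⟩
        (Set.range fun n : ℕ => ⟨Γ ++ List.replicate n A ++ Δ, C⟩)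
  | starR (Ps : List (List Formula)) (A : Formula) :
      Rule ⟨Ps.flatten, Formula.star A⟩ ((fun P => ⟨P, A⟩) '' {P | P ∈ Ps})

theorem Rule.sound {t : Sequent} {X : Set Sequent} (h : Rule t X) (hX : ∀ c ∈ X, Derivable c) :
    Derivable t := by
  unfold Derivable at *
  cases h with
  | id A => exact .id A
  | botL Γ Δ C => exact .botL Γ Δ C
  | topR Γ => exact .topR Γ
  | oneL Γ Δ C => exact .oneL _ _ _ (hX _ rfl)
  | oneR => exact .oneR
  | mulL Γ Δ A B C => exact .mulL _ _ _ _ _ (hX _ rfl)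
  | mulR Γ Δ A B => exact .mulR _ _ _ _ (hX _ (.inl rfl)) (hX _ (.inr rfl))
  | ldivL Γ Δ P A B C => exact .ldivL _ _ _ _ _ _ (hX _ (.inl rfl)) (hX _ (.inr rfl))
  | ldivR P A B => exact .ldivR _ _ _ (hX _ rfl)
  | rdivL Γ Δ P A B C => exact .rdivL _ _ _ _ _ _ (hX _ (.inl rfl)) (hX _ (.inr rfl))
  | rdivR P A B => exact .rdivR _ _ _ (hX _ rfl)
  | andL₁ Γ Δ A B C => exact .andL₁ _ _ _ _ _ (hX _ rfl)
  | andL₂ Γ Δ A B C => exact .andL₂ _ _ _ _ _ (hX _ rfl)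
  | andR P A B => exact .andR _ _ _ (hX _ (.inl rfl)) (hX _ (.inr rfl))
  | orL Γ Δ A B C => exact .orL _ _ _ _ _ (hX _ (.inl rfl)) (hX _ (.inr rfl))
  | orR₁ P A B => exact .orR₁ _ _ _ (hX _ rfl)
  | orR₂ P A B => exact .orR₂ _ _ _ (hX _ rfl)
  | starL Γ Δ A C => exact .starL _ _ _ _ fun n => hX _ ⟨n, rfl⟩
  | starR Ps A => exact .starR _ _ fun P hP => hX _ ⟨P, hP, rfl⟩

/-- The multiset of the sizes of the formulae in a list. -/
noncomputable def weight (l : List Formula) : Multiset ℕ := (l.map sizeOf : List ℕ)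

theorem weight_nil : weight [] = 0 := rfl

theorem weight_append (l m : List Formula) : weight (l ++ m) = weight l + weight m := by
  simp [weight]

theorem weight_cons (A : Formula) (l : List Formula) :
    weight (A :: l) = {sizeOf A} + weight l := by
  simp [weight, ← Multiset.cons_coe]

theorem weight_replicate (A : Formula) (n : ℕ) :
    weight (List.replicate n A) = Multiset.replicate n (sizeOf A) := by
  simp [weight, Multiset.coe_replicate]

/-- The multiset of the sizes of the formulae in a sequent. -/
noncomputable def Sequent.weight (t : Sequent) : Multiset ℕ := {sizeOf t.succ} + ACT.weight t.ante

theorem isDershowitzMannaLT_of_lt {M N : Multiset ℕ} (X Y W : Multiset ℕ) (z : ℕ)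
    (hM : M = X + Y) (hN : N = X + ({z} + W)) (h : ∀ y ∈ Y, y < z) :
    M.IsDershowitzMannaLT N :=
  ⟨X, Y, {z} + W, by simp, hM, hN, fun y hy => ⟨z, by simp, h y hy⟩⟩

/-- Each premise trades the principal formula for proper subformulae of it and possibly drops other
formulae. A multiset order is needed because `starL` produces arbitrarily many copies of $A$. -/
theorem Rule.weight_lt {t c : Sequent} {X : Set Sequent} (h : Rule t X) (hc : c ∈ X) :
    c.weight.IsDershowitzMannaLT t.weight := by
  have close : ∀ {t c : Sequent} (U Y W : Multiset ℕ) (z : ℕ),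
      c.weight = U + Y → t.weight = U + ({z} + W) → (∀ y ∈ Y, y < z) →
      c.weight.IsDershowitzMannaLT t.weight := fun U Y W z => isDershowitzMannaLT_of_lt U Y W z
  cases h
  case id | botL | topR | oneR => exact hc.elim
  case starR Ps A =>
    obtain ⟨P, hP, rfl⟩ := hc
    -- `U` and `V` are the parts of the antecedent around the block `P`, absent from this premise.
    -- Even if both are empty, the succedent has shrunk from $A^*$ to $A$.
    obtain ⟨U, V, hUV⟩ := List.infix_of_mem_flatten hP
    refine close (weight P) {sizeOf A} (weight U + weight V) (sizeOf (Formula.star A)) ?_ ?_ ?_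
    · simp [Sequent.weight, add_comm]
    · simp only [Sequent.weight, ← hUV, weight_append]; abel
    · simp
  case starL Γ Δ A C =>
    obtain ⟨n, rfl⟩ := hc
    refine close (weight Γ + weight Δ + {sizeOf C}) (Multiset.replicate n (sizeOf A)) 0
      (sizeOf (Formula.star A)) ?_ ?_ ?_
    · simp only [Sequent.weight, weight_append, weight_replicate]; abel
    · simp only [Sequent.weight, weight_append, weight_cons, weight_nil]; abel
    · intro y hy
      rw [Multiset.eq_of_mem_replicate hy]
      simp
  case' oneL Γ Δ C =>
    obtain rfl := hc
    refine close (weight Γ + weight Δ + {sizeOf C}) 0 0 (sizeOf (Formula.one)) ?_ ?_ ?_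
  case' mulL Γ Δ A B C =>
    obtain rfl := hc
    refine close (weight Γ + weight Δ + {sizeOf C}) {sizeOf A, sizeOf B} 0 (sizeOf (Formula.mul A B))
        ?_ ?_ ?_
  case' mulR Γ Δ A B =>
    rcases hc with rfl | rfl
    case' inl =>
      refine close (weight Γ) {sizeOf A} (weight Δ) (sizeOf (Formula.mul A B)) ?_ ?_ ?_
    case' inr =>
      refine close (weight Δ) {sizeOf B} (weight Γ) (sizeOf (Formula.mul A B)) ?_ ?_ ?_
  case' ldivL Γ Δ P A B C =>
    rcases hc with rfl | rfl
    case' inl =>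
      refine close (weight P) {sizeOf A} (weight Γ + weight Δ + {sizeOf C}) (sizeOf (Formula.ldiv A B))
        ?_ ?_ ?_
    case' inr =>
      refine close (weight Γ + weight Δ + {sizeOf C}) {sizeOf B} (weight P) (sizeOf (Formula.ldiv A B))
        ?_ ?_ ?_
  case' ldivR P A B =>
    obtain rfl := hc
    refine close (weight P) {sizeOf A, sizeOf B} 0 (sizeOf (Formula.ldiv A B)) ?_ ?_ ?_
  case' rdivL Γ Δ P A B C =>
    rcases hc with rfl | rfl
    case' inl =>
      refine close (weight P) {sizeOf A} (weight Γ + weight Δ + {sizeOf C}) (sizeOf (Formula.rdiv B A))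
        ?_ ?_ ?_
    case' inr =>
      refine close (weight Γ + weight Δ + {sizeOf C}) {sizeOf B} (weight P) (sizeOf (Formula.rdiv B A))
        ?_ ?_ ?_
  case' rdivR P A B =>
    obtain rfl := hc
    refine close (weight P) {sizeOf A, sizeOf B} 0 (sizeOf (Formula.rdiv B A)) ?_ ?_ ?_
  case' andL₁ Γ Δ A B C =>
    obtain rfl := hc
    refine close (weight Γ + weight Δ + {sizeOf C}) {sizeOf A} 0 (sizeOf (Formula.and A B)) ?_ ?_ ?_
  case' andL₂ Γ Δ A B C =>
    obtain rfl := hc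
    refine close (weight Γ + weight Δ + {sizeOf C}) {sizeOf B} 0 (sizeOf (Formula.and A B)) ?_ ?_ ?_
  case' andR P A B =>
    rcases hc with rfl | rfl
    case' inl =>
      refine close (weight P) {sizeOf A} 0 (sizeOf (Formula.and A B)) ?_ ?_ ?_
    case' inr =>
      refine close (weight P) {sizeOf B} 0 (sizeOf (Formula.and A B)) ?_ ?_ ?_
  case' orL Γ Δ A B C =>
    rcases hc with rfl | rfl
    case' inl =>
      refine close (weight Γ + weight Δ + {sizeOf C}) {sizeOf A} 0 (sizeOf (Formula.or A B))
        ?_ ?_ ?_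
    case' inr =>
      refine close (weight Γ + weight Δ + {sizeOf C}) {sizeOf B} 0 (sizeOf (Formula.or A B))
        ?_ ?_ ?_
  case' orR₁ P A B =>
    obtain rfl := hc
    refine close (weight P) {sizeOf A} 0 (sizeOf (Formula.or A B)) ?_ ?_ ?_
  case' orR₂ P A B =>
    obtain rfl := hc
    refine close (weight P) {sizeOf B} 0 (sizeOf (Formula.or A B)) ?_ ?_ ?_
  all_goals
    first
      | (simp only [Sequent.weight, weight_append, weight_cons, weight_nil,
          Multiset.insert_eq_cons, ← Multiset.singleton_add]; abel1)
      | (simp <;> omega)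

/-! ### Subformulae -/

/-- The immediate subformulae of a formula. -/
def Formula.parts : Formula → Set Formula
  | .ldiv A B | .rdiv A B | .mul A B | .and A B | .or A B => {A, B}
  | .star A => {A}
  | _ => ∅

/-- A set of formulae closed under taking subformulae. -/
def SubClosed (S : Set Formula) : Prop := ∀ A ∈ S, A.parts ⊆ S

theorem SubClosed.union {S T : Set Formula} (hS : SubClosed S) (hT : SubClosed T) :
    SubClosed (S ∪ T) := by
  rintro A (hA | hA)
  · exact (hS A hA).trans Set.subset_union_left
  · exact (hT A hA).trans Set.subset_union_right

theorem SubClosed.insert {S : Set Formula} (hS : SubClosed S) {A : Formula} (hA : A.parts ⊆ S) :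
    SubClosed (insert A S) := by
  rintro B (rfl | hB)
  · exact hA.trans (Set.subset_insert _ _)
  · exact (hS B hB).trans (Set.subset_insert _ _)

theorem exists_finite_subClosed_mem (A : Formula) : ∃ S, A ∈ S ∧ S.Finite ∧ SubClosed S := by
  have h₀ : ∀ A : Formula, A.parts = ∅ → ∃ S, A ∈ S ∧ S.Finite ∧ SubClosed S := fun A hA =>
    ⟨insert A ∅, Set.mem_insert _ _, Set.toFinite _,
      SubClosed.insert (fun _ h => h.elim) hA.subset⟩
  have h₂ : ∀ A B D : Formula, D.parts = {A, B} →
      (∃ S, A ∈ S ∧ S.Finite ∧ SubClosed S) → (∃ S, B ∈ S ∧ S.Finite ∧ SubClosed S) →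
      ∃ S, D ∈ S ∧ S.Finite ∧ SubClosed S := by
    rintro A B D hD ⟨S, hA, hS, hS'⟩ ⟨T, hB, hT, hT'⟩
    refine ⟨Insert.insert D (S ∪ T), Set.mem_insert _ _, (hS.union hT).insert _,
      (hS'.union hT').insert ?_⟩
    rw [hD]
    rintro E (rfl | rfl)
    exacts [.inl hA, .inr hB]
  induction A with
  | var n => exact h₀ _ rfl
  | top => exact h₀ _ rfl
  | bot => exact h₀ _ rfl
  | one => exact h₀ _ rfl
  | ldiv A B hA hB => exact h₂ A B _ rfl hA hB
  | rdiv A B hA hB => exact h₂ A B _ rfl hA hB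
  | mul A B hA hB => exact h₂ A B _ rfl hA hB
  | and A B hA hB => exact h₂ A B _ rfl hA hB
  | or A B hA hB => exact h₂ A B _ rfl hA hB
  | star A hA => exact h₂ A A _ (Set.pair_eq_singleton A).symm hA hA

theorem exists_finite_subClosed (l : List Formula) :
    ∃ S, (∀ A ∈ l, A ∈ S) ∧ S.Finite ∧ SubClosed S := by
  induction l with
  | nil => exact ⟨∅, by simp, Set.finite_empty, fun _ h => h.elim⟩
  | cons A l ih =>
    obtain ⟨S, hl, hS, hS'⟩ := ih
    obtain ⟨T, hA, hT, hT'⟩ := exists_finite_subClosed_mem A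
    refine ⟨T ∪ S, ?_, hT.union hS, hT'.union hS'⟩
    rintro B hB
    rcases List.mem_cons.1 hB with rfl | hB
    exacts [.inl hA, .inr (hl B hB)]

/-! ### Finite sets of underivable sequents -/

/-- Sets of premises are counted rather than rule instances: empty blocks in `starR` allow
infinitely many instances with the same conclusion. Outside `starL`, all premises lie in a finite
set of sequents whose antecedent is two sublists of the old one around at most two subformulae. For
`starL` the infinite set of premises is determined by $\Gamma$, $\Delta$ and $A$. -/
theorem finite_setOf_rule (t : Sequent) : {X | Rule t X}.Finite := by
  obtain ⟨S, hl, hS, hS'⟩ := exists_finite_subClosed (t.succ :: t.ante)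
  have hsucc : t.succ ∈ S := hl _ (by simp)
  have hante : ∀ A ∈ t.ante, A ∈ S := fun A hA => hl A (by simp [hA])
  have h𝓛 : {l : List Formula | l.Sublist t.ante}.Finite :=
    (t.ante.sublists.finite_toSet).subset fun l hl => List.mem_sublists.2 hl
  have hQ : ((fun p : List Formula × List Formula × List Formula × Formula =>
      (⟨p.1 ++ p.2.1 ++ p.2.2.1, p.2.2.2⟩ : Sequent)) ''
      ({l : List Formula | l.Sublist t.ante} ×ˢ
        ({[]} ∪ ((fun A => [A]) '' S) ∪ Set.image2 (fun A B => [A, B]) S S)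
        ×ˢ {l : List Formula | l.Sublist t.ante} ×ˢ S)).Finite := by
    refine Set.Finite.image _ (h𝓛.prod (Set.Finite.prod ?_ (h𝓛.prod hS)))
    exact ((Set.finite_singleton _).union (hS.image _)).union (hS.image2 _ hS)
  have hR : ((fun p : List Formula × List Formula × Formula => Set.range fun n : ℕ =>
      (⟨p.1 ++ List.replicate n p.2.2 ++ p.2.1, t.succ⟩ : Sequent)) ''
      ({l : List Formula | l.Sublist t.ante} ×ˢ {l | l.Sublist t.ante} ×ˢ S)).Finite :=
    Set.Finite.image _ (h𝓛.prod (h𝓛.prod hS))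
  refine (hQ.finite_subsets.union hR).subset ?_
  set Q := (fun p : List Formula × List Formula × List Formula × Formula =>
      (⟨p.1 ++ p.2.1 ++ p.2.2.1, p.2.2.2⟩ : Sequent)) '' _ with hQdef
  have q₀ : ∀ Γ Δ D, Γ.Sublist t.ante → Δ.Sublist t.ante → D ∈ S →
      (⟨Γ ++ Δ, D⟩ : Sequent) ∈ Q := fun Γ Δ D hΓ hΔ hD =>
    ⟨⟨Γ, [], Δ, D⟩, ⟨hΓ, .inl (.inl rfl), hΔ, hD⟩, by simp⟩
  have q : ∀ Γ D, Γ.Sublist t.ante → D ∈ S → (⟨Γ, D⟩ : Sequent) ∈ Q := fun Γ D hΓ hD => by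
    simpa using q₀ Γ [] D hΓ (List.nil_sublist _) hD
  have q₁ : ∀ Γ A Δ D, Γ.Sublist t.ante → A ∈ S → Δ.Sublist t.ante → D ∈ S →
      (⟨Γ ++ [A] ++ Δ, D⟩ : Sequent) ∈ Q := fun Γ A Δ D hΓ hA hΔ hD =>
    ⟨⟨Γ, [A], Δ, D⟩, ⟨hΓ, .inl (.inr ⟨A, hA, rfl⟩), hΔ, hD⟩, rfl⟩
  have q₂ : ∀ Γ A B Δ D, Γ.Sublist t.ante → A ∈ S → B ∈ S → Δ.Sublist t.ante → D ∈ S →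
      (⟨Γ ++ [A, B] ++ Δ, D⟩ : Sequent) ∈ Q := fun Γ A B Δ D hΓ hA hB hΔ hD =>
    ⟨⟨Γ, [A, B], Δ, D⟩, ⟨hΓ, .inr ⟨A, hA, B, hB, rfl⟩, hΔ, hD⟩, rfl⟩
  clear_value Q
  have two : ∀ {a b : Sequent}, a ∈ Q → b ∈ Q → ({a, b} : Set Sequent) ⊆ Q := fun ha hb =>
    Set.insert_subset ha (Set.singleton_subset_iff.2 hb)
  have parts₂ : ∀ {A B D : Formula}, D ∈ S → D.parts = {A, B} → A ∈ S ∧ B ∈ S :=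
    fun {A B D} hD e => ⟨hS' D hD (by simp [e]), hS' D hD (by simp [e])⟩
  have subL : ∀ {Γ Δ : List Formula}, Γ.Sublist (Γ ++ Δ) := List.sublist_append_left _ _
  have subR : ∀ {Γ Δ : List Formula}, Δ.Sublist (Γ ++ Δ) := List.sublist_append_right _ _
  have mid : ∀ {Γ Δ : List Formula} {A : Formula}, A ∈ Γ ++ [A] ++ Δ := by simp
  intro X hX
  cases hX with
  | id A => exact .inl (Set.empty_subset _)
  | botL Γ Δ C => exact .inl (Set.empty_subset _)
  | topR Γ => exact .inl (Set.empty_subset _)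
  | oneL Γ Δ C =>
    exact .inl (Set.singleton_subset_iff.2 (q₀ _ _ _ (subL.trans subL) subR hsucc))
  | oneR => exact .inl (Set.empty_subset _)
  | mulL Γ Δ A B C =>
    obtain ⟨hA, hB⟩ := parts₂ (hante _ mid) rfl
    exact .inl (Set.singleton_subset_iff.2 (q₂ _ _ _ _ _ (subL.trans subL) hA hB subR hsucc))
  | mulR Γ Δ A B =>
    obtain ⟨hA, hB⟩ := parts₂ hsucc rfl
    exact .inl (two (q _ _ subL hA) (q _ _ subR hB))
  | ldivL Γ Δ P A B C =>
    obtain ⟨hA, hB⟩ := parts₂ (hante _ mid) rfl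
    exact .inl (two (q _ _ ((subR.trans subL).trans subL) hA)
      (q₁ _ _ _ _ ((subL.trans subL).trans subL) hB subR hsucc))
  | ldivR P A B =>
    obtain ⟨hA, hB⟩ := parts₂ hsucc rfl
    exact .inl (Set.singleton_subset_iff.2 (q₁ [] _ _ _ (List.nil_sublist _) hA (.refl _) hB))
  | rdivL Γ Δ P A B C =>
    obtain ⟨hB, hA⟩ := parts₂ (hante (.rdiv B A) (by simp)) rfl
    exact .inl (two (q _ _ (subR.trans subL) hA)
      (q₁ _ _ _ _ ((subL.trans subL).trans subL) hB subR hsucc))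
  | rdivR P A B =>
    obtain ⟨hB, hA⟩ := parts₂ hsucc rfl
    exact .inl (Set.singleton_subset_iff.2 (by
      simpa using q₁ P _ [] _ (.refl _) hA (List.nil_sublist _) hB))
  | andL₁ Γ Δ A B C =>
    obtain ⟨hA, hB⟩ := parts₂ (hante _ mid) rfl
    exact .inl (Set.singleton_subset_iff.2 (q₁ _ _ _ _ (subL.trans subL) hA subR hsucc))
  | andL₂ Γ Δ A B C =>
    obtain ⟨hA, hB⟩ := parts₂ (hante _ mid) rfl
    exact .inl (Set.singleton_subset_iff.2 (q₁ _ _ _ _ (subL.trans subL) hB subR hsucc))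
  | andR P A B =>
    obtain ⟨hA, hB⟩ := parts₂ hsucc rfl
    exact .inl (two (q _ _ (.refl _) hA) (q _ _ (.refl _) hB))
  | orL Γ Δ A B C =>
    obtain ⟨hA, hB⟩ := parts₂ (hante _ mid) rfl
    exact .inl (two (q₁ _ _ _ _ (subL.trans subL) hA subR hsucc)
      (q₁ _ _ _ _ (subL.trans subL) hB subR hsucc))
  | orR₁ P A B =>
    exact .inl (Set.singleton_subset_iff.2 (q _ _ (.refl _) (parts₂ hsucc rfl).1))
  | orR₂ P A B =>
    exact .inl (Set.singleton_subset_iff.2 (q _ _ (.refl _) (parts₂ hsucc rfl).2))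
  | starL Γ Δ A C =>
    have hA : A ∈ S := hS' _ (hante _ mid) rfl
    exact .inr ⟨⟨Γ, Δ, A⟩, ⟨subL.trans subL, subR, hA⟩, rfl⟩
  | starR Ps A =>
    refine .inl ?_
    rintro _ ⟨P, hP, rfl⟩
    exact q _ _ (List.infix_of_mem_flatten hP).sublist (hS' _ hsucc rfl)

/-- A set of sequents is a refutation if every rule (other than cut) whose conclusion is in the
set has a premise in the set. -/
def IsRefutation (F : Set Sequent) : Prop := ∀ t ∈ F, ∀ X, Rule t X → ∃ c ∈ X, c ∈ F

theorem exists_finite_isRefutation {s : Sequent} (hs : ¬ Derivable s) :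
    ∃ F : Set Sequent, s ∈ F ∧ F.Finite ∧ IsRefutation F := by
  have wf : WellFounded fun c t : Sequent => c.weight.IsDershowitzMannaLT t.weight :=
    InvImage.wf Sequent.weight Multiset.wellFounded_isDershowitzMannaLT
  induction s using wf.induction with
  | _ s ih =>
    have h : ∀ X : {X | Rule s X}, ∃ c ∈ X.1, ¬ Derivable c := by
      rintro ⟨X, hX⟩
      by_contra! h
      exact hs (hX.sound h)
    choose c hc hc' using h
    -- The chosen premises are smaller than `s`, so they have finite refutations already; their
    -- union with `s` is the refutation sought.
    choose F hF hfin href using fun X : {X | Rule s X} => ih (c X) (X.2.weight_lt (hc X)) (hc' X)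
    have := (finite_setOf_rule s).to_subtype
    refine ⟨insert s (⋃ X, F X), Set.mem_insert _ _, (Set.finite_iUnion hfin).insert _, ?_⟩
    rintro t (rfl | ht) X hX
    · exact ⟨c ⟨X, hX⟩, hc ⟨X, hX⟩, .inr (Set.mem_iUnion.2 ⟨_, hF _⟩)⟩
    · obtain ⟨Y, hY⟩ := Set.mem_iUnion.1 ht
      obtain ⟨d, hd, hd'⟩ := href Y t hY X hX
      exact ⟨d, hd, .inr (Set.mem_iUnion.2 ⟨Y, hd'⟩)⟩

/-! ### The model of a refutation -/

section Model

variable {S : Set Formula} {F : Set Sequent}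

/-- The word for a sequent: the antecedent in letters of the first kind, followed by the succedent
as a letter of the second kind. -/
def encode (Γ : List S) (D : S) : List (S ⊕ S) := Γ.map .inl ++ [.inr D]

theorem exists_of_map_eq_flatten {α β : Type*} {f : α → β} {l : List α} {L : List (List β)}
    (h : l.map f = L.flatten) : ∃ K : List (List α), l = K.flatten ∧ L = K.map (List.map f) := by
  induction L generalizing l with
  | nil => exact ⟨[], List.map_eq_nil_iff.1 h, rfl⟩
  | cons a L ih =>
    obtain ⟨l₁, l₂, rfl, rfl, h'⟩ := List.map_eq_append_iff.1 h
    obtain ⟨K, rfl, rfl⟩ := ih h'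
    exact ⟨l₁ :: K, rfl, rfl⟩

theorem encode_inj {Γ Δ : List S} {C D : S} : encode Γ C = encode Δ D ↔ Γ = Δ ∧ C = D := by
  rw [encode, encode, ← List.concat_eq_append, ← List.concat_eq_append, List.concat_inj,
    (List.map_injective_iff.2 Sum.inl_injective).eq_iff, Sum.inr.injEq]

/-- A word is marked if it contains a letter of the second kind. -/
def Marked (w : List (S ⊕ S)) : Prop := ∃ D : S, .inr D ∈ w

theorem marked_append {x y : List (S ⊕ S)} : Marked (x ++ y) ↔ Marked x ∨ Marked y := by
  simp [Marked, exists_or]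

theorem marked_append_inr (x : List (S ⊕ S)) (D : S) : Marked (x ++ [.inr D]) := ⟨D, by simp⟩

theorem not_marked_map_inl (Γ : List S) : ¬ Marked (Γ.map .inl) := by simp [Marked]

theorem not_marked_inl (A : S) : ¬ Marked [.inl A] := not_marked_map_inl [A]

variable (S F)

/-- The marked words that do not encode a sequent from `F`. -/
def refutationLang : Language (S ⊕ S) :=
  {w | Marked w ∧ ∀ (Γ : List S) (D : S), w = encode Γ D → (⟨Γ.map (↑), D⟩ : Sequent) ∉ F}

theorem isRegular_setOf_marked : Language.IsRegular ({w | Marked w} : Language (S ⊕ S)) := by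
  refine Language.IsRegular.of_finite_range_leftQuotient ?_
  refine (Set.toFinite {⊤, {w | Marked w}}).subset ?_
  rintro _ ⟨x, rfl⟩
  by_cases hx : Marked x
  · exact .inl (Set.eq_univ_of_forall fun y => marked_append.2 (.inl hx))
  · exact .inr (Set.ext fun y => marked_append.trans (or_iff_right hx))

theorem isRegular_refutationLang (hF : F.Finite) : (refutationLang S F).IsRegular := by
  let f : List S × S → Sequent := fun p => ⟨p.1.map (↑), p.2⟩
  have hf : Function.Injective f := by
    rintro ⟨Γ, C⟩ ⟨Δ, D⟩ h
    simp only [f, Sequent.mk.injEq] at h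
    exact Prod.ext (List.map_injective_iff.2 Subtype.val_injective h.1) (Subtype.ext h.2)
  have h : Language.IsRegular ((fun p => encode p.1 p.2) '' (f ⁻¹' F) : Language (S ⊕ S)) :=
    isRegular_of_finite ((hF.preimage hf.injOn).image _)
  convert (isRegular_setOf_marked S).inf h.compl
  ext w
  refine and_congr_right fun _ => ⟨?_, ?_⟩
  · rintro h ⟨p, hp, rfl⟩
    exact h _ _ rfl hp
  · exact fun h Γ D e hΓ => h ⟨(Γ, D), hΓ, e.symm⟩

variable {S F}

theorem exists_encode_of_notMem {w : List (S ⊕ S)} (hw : Marked w) (h : w ∉ refutationLang S F) :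
    ∃ (Γ : List S) (D : S), w = encode Γ D ∧ (⟨Γ.map (↑), D⟩ : Sequent) ∈ F := by
  by_contra! h'
  exact h ⟨hw, h'⟩

theorem encode_mem_refutationLang {Γ : List S} {D : S} :
    encode Γ D ∈ refutationLang S F ↔ (⟨Γ.map (↑), D⟩ : Sequent) ∉ F := by
  constructor
  · exact fun h => h.2 Γ D rfl
  · refine fun h => ⟨marked_append_inr _ _, fun Δ C e => ?_⟩
    obtain ⟨rfl, rfl⟩ := encode_inj.1 e
    exact h

/-- A code has its only letter of the second kind at the end, so a nonempty final piece takes that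
letter and all before it is plain antecedent. -/
theorem append_eq_encode {x y : List (S ⊕ S)} (hy : y ≠ []) {Γ : List S} {D : S}
    (h : x ++ y = encode Γ D) :
    ∃ Γ₁ Γ₂ : List S, x = Γ₁.map .inl ∧ y = encode Γ₂ D ∧ Γ = Γ₁ ++ Γ₂ := by
  rcases List.eq_nil_or_concat y with rfl | ⟨y, b, rfl⟩
  · exact absurd rfl hy
  · rw [encode, List.concat_eq_append, ← List.append_assoc, ← List.concat_eq_append,
      ← List.concat_eq_append, List.concat_inj] at h
    obtain ⟨e, rfl⟩ := h
    obtain ⟨Γ₁, Γ₂, rfl, rfl, rfl⟩ := List.map_eq_append_iff.1 e.symm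
    exact ⟨Γ₁, Γ₂, rfl, by simp [encode], rfl⟩

/-- Words outside the language with a letter of the first kind at a given place. -/
theorem exists_of_append_inl_notMem {x y : List (S ⊕ S)} {A : S} (hxy : Marked (x ++ y))
    (h : x ++ [.inl A] ++ y ∉ refutationLang S F) :
    ∃ (Γ Δ : List S) (D : S), x = Γ.map .inl ∧ y = encode Δ D ∧
      (⟨Γ.map (↑) ++ [A.1] ++ Δ.map (↑), D⟩ : Sequent) ∈ F := by
  have hm : Marked (x ++ [.inl A] ++ y) := by
    simp only [marked_append] at hxy ⊢
    tauto
  obtain ⟨Γ, D, e, hF⟩ := exists_encode_of_notMem hm h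
  rw [List.append_assoc] at e
  obtain ⟨Γ₁, Γ₂, rfl, e₁, rfl⟩ := append_eq_encode (by simp) e
  have hy : y ≠ [] := by
    rintro rfl
    rw [List.append_nil] at hxy
    exact not_marked_map_inl _ hxy
  obtain ⟨Γ₃, Δ, e₂, rfl, rfl⟩ := append_eq_encode hy e₁
  obtain ⟨B, rfl, hB⟩ := List.map_eq_singleton_iff.1 e₂.symm
  obtain rfl := Sum.inl_injective hB
  exact ⟨Γ₁, Δ, D, rfl, rfl, by simpa using hF⟩

theorem exists_of_append_inr_notMem {x : List (S ⊕ S)} {A : S}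
    (h : x ++ [.inr A] ∉ refutationLang S F) :
    ∃ Γ : List S, x = Γ.map .inl ∧ (⟨Γ.map (↑), A⟩ : Sequent) ∈ F := by
  obtain ⟨Γ, D, e, hF⟩ := exists_encode_of_notMem (marked_append_inr _ _) h
  rw [encode, ← List.concat_eq_append, ← List.concat_eq_append, List.concat_inj] at e
  obtain rfl := Sum.inr_injective e.2
  exact ⟨Γ, e.1, hF⟩

theorem append_encode_notMem {Γ Θ Δ : List S} {D : S}
    (h : (⟨Γ.map (↑) ++ Θ.map (↑) ++ Δ.map (↑), D⟩ : Sequent) ∈ F) :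
    Γ.map .inl ++ Θ.map .inl ++ encode Δ D ∉ refutationLang S F := by
  have e : Γ.map .inl ++ Θ.map .inl ++ encode Δ D = encode (Γ ++ Θ ++ Δ) D := by simp [encode]
  rw [e, encode_mem_refutationLang, not_not]
  simpa using h

variable (F) in
/-- The closed language of the words `w` such that `w → A` is not in `F`. -/
def rightLang (A : S) : Language (S ⊕ S) := wordsOf (refutationLang S F) {([], [.inr A])}

theorem mem_rightLang {A : S} {w : List (S ⊕ S)} :
    w ∈ rightLang F A ↔ w ++ [.inr A] ∈ refutationLang S F :=
  ⟨fun h => h _ rfl, by rintro h _ rfl; exact h⟩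

theorem cl_rightLang (A : S) : cl (refutationLang S F) (rightLang F A) = rightLang F A :=
  cl_of_le fun _ hv c hc => hv c fun _ hw => hw c hc

/-! ### The local zero generated by the letter $\bot$ -/

/-- The rule `botL` has no premises, so no sequent of a refutation has $\bot$ in its antecedent.
Thus the contexts of the letter $\bot$ are exactly the marked ones. The empty context is not among
them, so this letter lies outside the standard bottom. -/
theorem IsRefutation.append_bot_append_mem (hF : IsRefutation F) (hb : Formula.bot ∈ S)
    {x y : List (S ⊕ S)} :
    x ++ [.inl ⟨.bot, hb⟩] ++ y ∈ refutationLang S F ↔ Marked (x ++ y) := by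
  constructor
  · intro h
    have h := h.1
    simp only [marked_append, not_marked_inl, or_false] at h ⊢
    exact h
  · intro h
    by_contra h'
    obtain ⟨Γ, Δ, D, rfl, rfl, hm⟩ := exists_of_append_inl_notMem h h'
    obtain ⟨_, h, _⟩ := hF _ hm _ (.botL _ _ _)
    exact h

variable (F) in
/-- The closure of the one-letter word `⊥`. -/
def refutationBot (hb : Formula.bot ∈ S) : SCL (refutationLang S F) :=
  ⟨cl (refutationLang S F) {[.inl ⟨.bot, hb⟩]}, cl_cl _⟩

theorem refutationBot_le_iff (hb : Formula.bot ∈ S) {M : SCL (refutationLang S F)} :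
    refutationBot F hb ≤ M ↔ [.inl ⟨.bot, hb⟩] ∈ M.1 :=
  ⟨fun h => h (show [.inl ⟨.bot, hb⟩] ∈ cl (refutationLang S F) {[.inl ⟨.bot, hb⟩]} from
      le_cl _ rfl),
    fun h => cl_le M.2 (Set.singleton_subset_iff.2 h)⟩

theorem IsRefutation.mem_refutationBot_iff (hF : IsRefutation F) (hb : Formula.bot ∈ S)
    {v : List (S ⊕ S)} : v ∈ (refutationBot F hb).1 ↔
    ∀ x y, Marked (x ++ y) → x ++ v ++ y ∈ refutationLang S F := by
  constructor
  · intro h x y hxy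
    refine h (x, y) ?_
    rintro _ rfl
    exact (hF.append_bot_append_mem hb).2 hxy
  · exact fun h c hc => h c.1 c.2 ((hF.append_bot_append_mem hb).1 (hc _ rfl))

/-- A word containing the letter $\bot$ fits into every marked context, so products with the
generator stay inside. Conversely $\bot\bot$ lies in both products, and each of its contexts is
marked, hence a context of $\bot$. -/
theorem IsRefutation.isLocalZero_refutationBot (hF : IsRefutation F) (hb : Formula.bot ∈ S) :
    IsLocalZero (refutationBot F hb) := by
  intro M hM
  have hbM := (refutationBot_le_iff hb).1 hM
  have hbZ := (refutationBot_le_iff hb).1 (le_refl (refutationBot F hb))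
  have hm : ∀ {x v y : List (S ⊕ S)}, Marked (x ++ y) → Marked (x ++ v ++ y) := by
    intro x v y h
    simp only [marked_append] at h ⊢
    tauto
  have hbb : ∀ {N : SCL (refutationLang S F)},
      [.inl ⟨.bot, hb⟩] ++ [.inl ⟨.bot, hb⟩] ∈ N.1 → refutationBot F hb ≤ N := by
    intro N h
    rw [refutationBot_le_iff, ← N.2]
    intro c hc
    refine (hF.append_bot_append_mem hb).2 ?_
    have h := (hc _ h).1
    simp only [marked_append, not_marked_inl, or_false] at h ⊢
    exact h
  constructor
  · refine le_antisymm (cl_le (refutationBot F hb).2 ?_)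
      (hbb (le_cl (L := refutationLang S F) _ (Language.append_mem_mul hbM hbZ)))
    refine (mul_cl_le _ _).trans (cl_le (refutationBot F hb).2 ?_)
    intro w hw
    obtain ⟨m, _, _, rfl, rfl⟩ := Language.mem_mul.1 hw
    refine (hF.mem_refutationBot_iff hb).2 fun x y hxy => ?_
    rw [← List.append_assoc, hF.append_bot_append_mem hb]
    exact hm hxy
  · refine le_antisymm (cl_le (refutationBot F hb).2 ?_)
      (hbb (le_cl (L := refutationLang S F) _ (Language.append_mem_mul hbZ hbM)))
    refine (cl_mul_le _ _).trans (cl_le (refutationBot F hb).2 ?_)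
    intro w hw
    obtain ⟨_, rfl, m, _, rfl⟩ := Language.mem_mul.1 hw
    refine (hF.mem_refutationBot_iff hb).2 fun x y hxy => ?_
    rw [← List.append_assoc, List.append_assoc, hF.append_bot_append_mem hb, ← List.append_assoc]
    exact hm hxy

theorem IsRefutation.refutationBot_le_one (hF : IsRefutation F) (hb : Formula.bot ∈ S) :
    refutationBot F hb ≤ 1 := by
  rw [refutationBot_le_iff]
  intro c hc
  refine (hF.append_bot_append_mem hb).2 ?_
  simpa using (hc [] rfl).1

theorem IsRefutation.refutationBot_le_rightLang (hF : IsRefutation F) (hb : Formula.bot ∈ S) (A : S) :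
    refutationBot F hb ≤ ⟨rightLang F A, cl_rightLang A⟩ :=
  (refutationBot_le_iff hb).2 (mem_rightLang.2
    ((hF.append_bot_append_mem (x := []) hb).2 (marked_append_inr _ _)))

/-! ### The valuation and the truth lemma -/

variable (hF : IsRefutation F) (hb : Formula.bot ∈ S)

open Classical in
/-- The valuation of the model of a refutation. -/
noncomputable def refutationVal (n : ℕ) : UpperCone (refutationBot F hb)
    (hF.isLocalZero_refutationBot hb) (hF.refutationBot_le_one hb) :=
  if h : Formula.var n ∈ S then
    ⟨⟨rightLang F ⟨.var n, h⟩, cl_rightLang _⟩, hF.refutationBot_le_rightLang hb _⟩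
  -- The value here is immaterial: the truth lemma only concerns formulae in `S`.
  else ⊤

/-- The language interpreting a formula in the model of a refutation. -/
noncomputable def refutationInterp (A : Formula) : Language (S ⊕ S) :=
  (interp (refutationVal hF hb) A).1.1

theorem cl_refutationInterp (A : Formula) :
    cl (refutationLang S F) (refutationInterp hF hb A) = refutationInterp hF hb A :=
  (interp (refutationVal hF hb) A).1.2

/-- A word lies in the interpretation of a formula if it can be put into every context of it;
these contexts are marked. -/
theorem mem_refutationInterp {A : Formula} {w : List (S ⊕ S)}
    (h : ∀ x y, Marked (x ++ y) →
      (∀ v ∈ refutationInterp hF hb A, x ++ v ++ y ∈ refutationLang S F) →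
      x ++ w ++ y ∈ refutationLang S F) : w ∈ refutationInterp hF hb A := by
  rw [← cl_refutationInterp]
  -- The letter $\bot$ belongs to every interpretation, so a context of the interpretation is a
  -- context of $\bot$ and is therefore marked.
  refine fun c hc => h c.1 c.2 ((hF.append_bot_append_mem hb).1 (hc _ ?_)) hc
  exact (refutationBot_le_iff hb).1 (interp (refutationVal hF hb) A).2

theorem refutationInterp_le_rightLang {A : Formula} {B : S} {M : Language (S ⊕ S)}
    (e : refutationInterp hF hb A = cl (refutationLang S F) M)
    (h : ∀ w ∈ M, w ++ [.inr B] ∈ refutationLang S F) :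
    refutationInterp hF hb A ≤ rightLang F B := by
  rw [e]
  exact cl_le (cl_rightLang B) fun w hw => mem_rightLang.2 (h w hw)

/-- Left rules give the membership of the letter, right rules the upper bound. The two halves need
each other in the induction: for divisions, the left rule uses the upper bound for the denominator
and the right rule uses its letter. -/
theorem refutation_truth (hS : SubClosed S) (A : Formula) (hA : A ∈ S) :
    [.inl ⟨A, hA⟩] ∈ refutationInterp hF hb A ∧
      refutationInterp hF hb A ≤ rightLang F ⟨A, hA⟩ := by
  have one : ∀ {t c : Sequent}, t ∈ F → Rule t {c} → c ∈ F := by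
    intro t c ht h
    obtain ⟨_, rfl, h'⟩ := hF t ht _ h
    exact h'
  have two : ∀ {t c d : Sequent}, t ∈ F → Rule t {c, d} → c ∈ F ∨ d ∈ F := by
    intro t c d ht h
    obtain ⟨_, rfl | rfl, h'⟩ := hF t ht _ h
    exacts [.inl h', .inr h']
  have none : ∀ {t : Sequent}, t ∈ F → ¬ Rule t ∅ := by
    intro t ht h
    obtain ⟨_, h, _⟩ := hF t ht _ h
    exact h
  induction A with
  | var n =>
    have e : refutationInterp hF hb (.var n) = rightLang F ⟨.var n, hA⟩ := by
      simp [refutationInterp, interp, refutationVal, hA]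
    refine ⟨?_, e.le⟩
    rw [e, mem_rightLang]
    by_contra h
    obtain ⟨Γ, e, hs⟩ := exists_of_append_inr_notMem h
    obtain ⟨B, rfl, hB⟩ := List.map_eq_singleton_iff.1 e.symm
    obtain rfl := Sum.inl_injective hB
    exact none hs (.id _)
  | top =>
    refine ⟨trivial, fun w _ => mem_rightLang.2 ?_⟩
    by_contra h
    obtain ⟨Γ, e, hs⟩ := exists_of_append_inr_notMem h
    exact none hs (.topR _)
  | bot =>
    refine ⟨(refutationBot_le_iff hb).1 le_rfl,
      refutationInterp_le_rightLang hF hb (M := {[.inl ⟨.bot, hb⟩]}) rfl ?_⟩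
    rintro _ rfl
    exact (hF.append_bot_append_mem (x := []) hb).2 (marked_append_inr _ _)
  | one =>
    refine ⟨mem_refutationInterp hF hb fun x y hm hxy => ?_,
      refutationInterp_le_rightLang hF hb (M := 1) rfl ?_⟩
    · by_contra h
      obtain ⟨Γ, Δ, D, rfl, rfl, hs⟩ := exists_of_append_inl_notMem hm h
      refine append_encode_notMem (Θ := []) ?_ (hxy [] (le_cl (L := refutationLang S F) 1 rfl))
      simpa using one hs (.oneL _ _ _)
    · rintro w rfl
      by_contra h
      obtain ⟨Γ, e, hs⟩ := exists_of_append_inr_notMem h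
      obtain rfl := List.map_eq_nil_iff.1 e.symm
      exact none hs .oneR
  | ldiv A B ihA ihB =>
    obtain ⟨iA, jA⟩ := ihA (hS _ hA (.inl rfl))
    obtain ⟨iB, jB⟩ := ihB (hS _ hA (.inr rfl))
    constructor
    · intro v hv
      refine mem_refutationInterp hF hb (A := B) fun x y hm hxy => ?_
      by_contra h
      rw [← List.append_assoc] at h
      have hm' : Marked (x ++ v ++ y) := by
        simp only [marked_append] at hm ⊢
        tauto
      obtain ⟨Γ', Δ, D, e, rfl, hs⟩ := exists_of_append_inl_notMem hm' h
      obtain ⟨Γ, P, rfl, rfl, rfl⟩ := List.map_eq_append_iff.1 e.symm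
      rw [List.map_append] at hs
      rcases two hs (.ldivL _ _ _ _ _ _) with h | h
      · exact encode_mem_refutationLang.1 (mem_rightLang.1 (jA hv)) h
      · exact append_encode_notMem (Θ := [⟨B, _⟩]) h (hxy _ iB)
    · refine fun w hw => mem_rightLang.2 ?_
      by_contra h
      obtain ⟨Γ, rfl, hs⟩ := exists_of_append_inr_notMem h
      refine append_encode_notMem (Γ := []) (Θ := [⟨A, hS _ hA (.inl rfl)⟩]) (Δ := Γ)
        (D := ⟨B, hS _ hA (.inr rfl)⟩) (one hs (.ldivR _ _ _)) ?_
      simpa [encode] using mem_rightLang.1 (jB (hw _ iA))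
  | rdiv B A ihB ihA =>
    obtain ⟨iA, jA⟩ := ihA (hS _ hA (.inr rfl))
    obtain ⟨iB, jB⟩ := ihB (hS _ hA (.inl rfl))
    constructor
    · intro v hv
      refine mem_refutationInterp hF hb (A := B) fun x y hm hxy => ?_
      by_contra h
      rw [← List.append_assoc, List.append_assoc] at h
      have hm' : Marked (x ++ (v ++ y)) := by
        simp only [marked_append] at hm ⊢
        tauto
      obtain ⟨Γ, Δ', D, rfl, e, hs⟩ := exists_of_append_inl_notMem hm' h
      -- The word `v` might itself carry the succedent letter; markedness of the context excludes
      -- this by forcing that letter into `y`.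
      have hy : y ≠ [] := by
        rintro rfl
        rw [List.append_nil] at hm
        exact not_marked_map_inl _ hm
      obtain ⟨P, Δ, rfl, rfl, rfl⟩ := append_eq_encode hy e
      rw [List.map_append, ← List.append_assoc] at hs
      rcases two hs (.rdivL _ _ _ _ _ _) with h | h
      · exact encode_mem_refutationLang.1 (mem_rightLang.1 (jA hv)) h
      · exact append_encode_notMem (Θ := [⟨B, _⟩]) h (hxy _ iB)
    · refine fun w hw => mem_rightLang.2 ?_
      by_contra h
      obtain ⟨Γ, rfl, hs⟩ := exists_of_append_inr_notMem h
      refine append_encode_notMem (Γ := Γ) (Θ := [⟨A, hS _ hA (.inr rfl)⟩]) (Δ := [])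
        (D := ⟨B, hS _ hA (.inl rfl)⟩) (by simpa using one hs (.rdivR _ _ _)) ?_
      simpa [encode] using mem_rightLang.1 (jB (hw _ iA))
  | mul A B ihA ihB =>
    obtain ⟨iA, jA⟩ := ihA (hS _ hA (.inl rfl))
    obtain ⟨iB, jB⟩ := ihB (hS _ hA (.inr rfl))
    refine ⟨mem_refutationInterp hF hb fun x y hm hxy => ?_,
      refutationInterp_le_rightLang hF hb
        (M := refutationInterp hF hb A * refutationInterp hF hb B) rfl ?_⟩
    · by_contra h
      obtain ⟨Γ, Δ, D, rfl, rfl, hs⟩ := exists_of_append_inl_notMem hm h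
      exact append_encode_notMem (Θ := [⟨A, _⟩, ⟨B, _⟩]) (one hs (.mulL _ _ _ _ _))
        (hxy _ (le_cl (L := refutationLang S F) _ (Language.append_mem_mul iA iB)))
    · intro w hw
      obtain ⟨u, hu, v, hv, rfl⟩ := Language.mem_mul.1 hw
      by_contra h
      obtain ⟨Γ', e, hs⟩ := exists_of_append_inr_notMem h
      obtain ⟨Γ, Δ, rfl, rfl, rfl⟩ := List.map_eq_append_iff.1 e.symm
      rw [List.map_append] at hs
      rcases two hs (.mulR _ _ _ _) with h | h
      · exact encode_mem_refutationLang.1 (mem_rightLang.1 (jA hu)) h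
      · exact encode_mem_refutationLang.1 (mem_rightLang.1 (jB hv)) h
  | and A B ihA ihB =>
    obtain ⟨iA, jA⟩ := ihA (hS _ hA (.inl rfl))
    obtain ⟨iB, jB⟩ := ihB (hS _ hA (.inr rfl))
    refine ⟨⟨?_, ?_⟩, fun w hw => mem_rightLang.2 ?_⟩
    · refine mem_refutationInterp hF hb (A := A) fun x y hm hxy => ?_
      by_contra h
      obtain ⟨Γ, Δ, D, rfl, rfl, hs⟩ := exists_of_append_inl_notMem hm h
      exact append_encode_notMem (Θ := [⟨A, _⟩]) (one hs (.andL₁ _ _ _ _ _)) (hxy _ iA)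
    · refine mem_refutationInterp hF hb (A := B) fun x y hm hxy => ?_
      by_contra h
      obtain ⟨Γ, Δ, D, rfl, rfl, hs⟩ := exists_of_append_inl_notMem hm h
      exact append_encode_notMem (Θ := [⟨B, _⟩]) (one hs (.andL₂ _ _ _ _ _)) (hxy _ iB)
    · by_contra h
      obtain ⟨Γ, rfl, hs⟩ := exists_of_append_inr_notMem h
      rcases two hs (.andR _ _ _) with h | h
      · exact encode_mem_refutationLang.1 (mem_rightLang.1 (jA hw.1)) h
      · exact encode_mem_refutationLang.1 (mem_rightLang.1 (jB hw.2)) h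
  | or A B ihA ihB =>
    obtain ⟨iA, jA⟩ := ihA (hS _ hA (.inl rfl))
    obtain ⟨iB, jB⟩ := ihB (hS _ hA (.inr rfl))
    refine ⟨mem_refutationInterp hF hb fun x y hm hxy => ?_,
      refutationInterp_le_rightLang hF hb
        (M := refutationInterp hF hb A ⊔ refutationInterp hF hb B) rfl ?_⟩
    · by_contra h
      obtain ⟨Γ, Δ, D, rfl, rfl, hs⟩ := exists_of_append_inl_notMem hm h
      rcases two hs (.orL _ _ _ _ _) with h | h
      · exact append_encode_notMem (Θ := [⟨A, _⟩]) h
          (hxy _ (le_cl (L := refutationLang S F) _ (.inl iA)))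
      · exact append_encode_notMem (Θ := [⟨B, _⟩]) h
          (hxy _ (le_cl (L := refutationLang S F) _ (.inr iB)))
    · intro w hw
      by_contra h
      obtain ⟨Γ, rfl, hs⟩ := exists_of_append_inr_notMem h
      rcases hw with hw | hw
      · exact encode_mem_refutationLang.1 (mem_rightLang.1 (jA hw)) (one hs (.orR₁ _ _ _))
      · exact encode_mem_refutationLang.1 (mem_rightLang.1 (jB hw)) (one hs (.orR₂ _ _ _))
  | star A ihA =>
    have hA' : A ∈ S := hS _ hA rfl
    obtain ⟨iA, jA⟩ := ihA hA'
    refine ⟨mem_refutationInterp hF hb fun x y hm hxy => ?_,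
      refutationInterp_le_rightLang hF hb (M := KStar.kstar (refutationInterp hF hb A)) rfl ?_⟩
    · by_contra h
      obtain ⟨Γ, Δ, D, rfl, rfl, hs⟩ := exists_of_append_inl_notMem hm h
      -- The refutation supplies a single exponent $n$, and the word $A^n$ already lies in the
      -- Kleene star.
      obtain ⟨_, ⟨n, rfl⟩, h⟩ := hF _ hs _ (.starL _ _ _ _)
      refine append_encode_notMem (Θ := List.replicate n ⟨A, hA'⟩) (by simpa using h) (hxy _ ?_)
      refine le_cl (L := refutationLang S F) (KStar.kstar (refutationInterp hF hb A)) ?_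
      rw [List.map_replicate]
      exact Language.mem_kstar.2 ⟨List.replicate n [.inl ⟨A, hA'⟩], by simp, fun v hv => by
        rwa [List.eq_of_mem_replicate hv]⟩
    · intro w hw
      obtain ⟨Ps, rfl, hPs⟩ := Language.mem_kstar.1 hw
      by_contra h
      obtain ⟨Γ, e, hs⟩ := exists_of_append_inr_notMem h
      -- The factorisation of the word is lifted to the list of formulae, so that it becomes an
      -- instance of `starR`.
      obtain ⟨Qs, rfl, rfl⟩ := exists_of_map_eq_flatten e.symm
      rw [List.map_flatten] at hs
      obtain ⟨_, ⟨P, hP, rfl⟩, hs⟩ := hF _ hs _ (.starR _ _)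
      obtain ⟨Q, hQ, rfl⟩ := List.mem_map.1 hP
      exact encode_mem_refutationLang.1
        (mem_rightLang.1 (jA (hPs _ (List.mem_map_of_mem hQ)))) hs

theorem map_inl_mem_prod (hS : SubClosed S) (Γ : List S) :
    Γ.map .inl ∈ ((Γ.map (↑)).map (interp (refutationVal hF hb))).prod.1.1 := by
  induction Γ with
  | nil => exact le_cl (L := refutationLang S F) 1 rfl
  | cons A Γ ih =>
    exact le_cl (L := refutationLang S F) _
      (Language.append_mem_mul (refutation_truth hF hb hS A.1 A.2).1 ih)

end Model

/-! ### Weak completeness -/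

theorem weaklyComplete_isRegular : WeaklyComplete {M | M.IsRegular} := by
  intro s hs
  by_contra h
  obtain ⟨F, hsF, hfin, hF⟩ := exists_finite_isRefutation h
  -- $\bot$ is included even if it does not occur in `s`, since its letter generates the local zero.
  obtain ⟨S, hl, hSfin, hS⟩ := exists_finite_subClosed (.bot :: s.succ :: s.ante)
  have := hSfin.to_subtype
  have hb : Formula.bot ∈ S := hl _ (by simp)
  have hM := hs
    { Alphabet := S ⊕ S
      L := refutationLang S F
      Z := refutationBot F hb
      isLocalZero := hF.isLocalZero_refutationBot hb
      le_one := hF.refutationBot_le_one hb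
      val := refutationVal hF hb } ⟨inferInstance, isRegular_refutationLang S F hfin⟩
  have hsucc : s.succ ∈ S := hl _ (by simp)
  obtain ⟨Γ, hΓ⟩ : ∃ Γ : List S, Γ.map (↑) = s.ante :=
    ⟨s.ante.attachWith _ fun A hA => hl A (by simp [hA]), by simp⟩
  have hw := map_inl_mem_prod hF hb hS Γ
  rw [hΓ] at hw
  -- Truth of `s` would carry the antecedent word into the interpretation of the succedent, and thus
  -- keep `s` out of `F`.
  have hw' : Γ.map .inl ∈ refutationInterp hF hb s.succ := hM hw
  refine encode_mem_refutationLang.1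
    (mem_rightLang.1 ((refutation_truth hF hb hS _ hsucc).2 hw')) ?_
  rwa [hΓ]

end ACT

theorem mainTheorem4 :
    (∀ (α : Type) (L : Language α), Finite (ACT.SCL L) ↔ L.IsRegular) ∧
    ACT.WeaklyComplete {M | M.IsFinite} ∧
    ACT.WeaklyComplete {M | M.IsRegular} :=
  ⟨fun _ _ => ⟨ACT.isRegular_of_finite_scl, ACT.finite_scl_of_isRegular⟩,
    fun s hs => ACT.weaklyComplete_isRegular s fun M hM =>
      hs M (ACT.finite_scl_of_isRegular hM.2),
    ACT.weaklyComplete_isRegular⟩
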